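/- Let $n\ge 1$ and let $U\subset\mathbb R^n$ be a bounded Lipschitz domain, i.e. a nonempty bounded connected open set such that every $x_0\in\partial U$ has a ball around it in which, in suitable orthonormal coordinates, $U$ coincides with the set of points lying strictly above the graph of a Lipschitz function $\mathbb R^{n-1}\to\mathbb R$. Let $0<h<1$ and $0<q<n/h$. Let $W^{h,q}(U)$ be the set of (a.e. classes of) measurable functions $f:U\to\mathbb R$ with $$\|f\|_{W^{h,q}(U)}:=\left(\int_U|f|^q\,dx+\int_U\int_U\frac{|f(x)-f(y)|^q}{|x-y|^{n+hq}}\,dx\,dy\right)^{1/q}<\infty,$$ and for $r>0$ let $\|f\|_{L^{r}(U)}:=\left(\int_U|f|^{r}\,dx\right)^{1/r}$ (when $q<1$, resp. $r<1$, these are only quasinorms). Then for every $\tilde q$ with $$q\le\tilde q<\frac{nq}{n-hq},$$ the embedding of $W^{h,q}(U)$ into $L^{\tilde q}(U)$ is compact: $W^{h,q}(U)\subset L^{\tilde q}(U)$; there is a constant $C<\infty$ with $\|f\|_{L^{\tilde q}(U)}\le C\|f\|_{W^{h,q}(U)}$ for all $f\in W^{h,q}(U)$; and every sequence $(f_j)$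 in $W^{h,q}(U)$ with $\sup_j\|f_j\|_{W^{h,q}(U)}<\infty$ has a subsequence converging in $L^{\tilde q}(U)$, i.e. there are $g\in L^{\tilde q}(U)$ and indices $j_1<j_2<\cdots$ with $\|f_{j_k}-g\|_{L^{\tilde q}(U)}\to 0$. -/

import Mathlib

open MeasureTheory Filter Topology
open scoped ENNReal NNReal

/-- `U` is a Lipschitz domain in `ℝⁿ`: a nonempty connected open set such that near each boundary
point `x₀`, in suitable orthonormal coordinates with last axis `e`, the set `U` is the strict
epigraph of a Lipschitz function of the remaining coordinates.
Here `x - ⟪e, x⟫ e` is the orthogonal projection of `x` to the hyperplane orthogonal to `e`; only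
the values of `γ` on that hyperplane matter (a Lipschitz function on the hyperplane is the same as
the restriction to it of a Lipschitz function on the whole space). -/
def IsLipschitzDomain {n : ℕ} (U : Set (EuclideanSpace ℝ (Fin n))) : Prop :=
  IsOpen U ∧ IsConnected U ∧
    ∀ x₀ ∈ frontier U, ∃ r : ℝ, 0 < r ∧
      ∃ e : EuclideanSpace ℝ (Fin n), ‖e‖ = 1 ∧
        ∃ (K : ℝ≥0) (γ : EuclideanSpace ℝ (Fin n) → ℝ), LipschitzWith K γ ∧
          ∀ x ∈ Metric.ball x₀ r,
            (x ∈ U ↔ γ (x - inner ℝ e x • e) < inner ℝ e x)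

/-- The quasinorm of `W^{h,q}(U)`, with value `∞` allowed:
`(∫_U |f|^q dx + ∫_U ∫_U |f(x) - f(y)|^q / |x - y|^(n + h q) dx dy)^(1/q)`.
The quotient is `0` on the diagonal. -/
noncomputable def fracSobolevNorm {n : ℕ} (h q : ℝ) (U : Set (EuclideanSpace ℝ (Fin n)))
    (f : EuclideanSpace ℝ (Fin n) → ℝ) : ℝ≥0∞ :=
  ((∫⁻ x in U, ‖f x‖ₑ ^ q) +
    ∫⁻ y in U, ∫⁻ x in U, ‖f x - f y‖ₑ ^ q / ‖x - y‖ₑ ^ ((n : ℝ) + h * q)) ^ (1 / q)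

/-- Membership in `W^{h,q}(U)`: (a.e. strongly) measurable on `U` with finite quasinorm. -/
def MemFracSobolev {n : ℕ} (h q : ℝ) (U : Set (EuclideanSpace ℝ (Fin n)))
    (f : EuclideanSpace ℝ (Fin n) → ℝ) : Prop :=
  AEStronglyMeasurable f (volume.restrict U) ∧ fracSobolevNorm h q U f < ∞

/-- `W^{h,q}(U)` is compactly embedded into `L^r(U)`: it is contained in `L^r(U)`, the inclusion is
bounded, and each sequence bounded in `W^{h,q}(U)` has a subsequence converging in `L^r(U)`.
For `r < 1` the expression `eLpNorm` is the usual quasinorm `(∫_U |f|^r)^(1/r)`. -/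
def CompactlyEmbedsInLp {n : ℕ} (h q r : ℝ) (U : Set (EuclideanSpace ℝ (Fin n))) : Prop :=
  (∀ f : EuclideanSpace ℝ (Fin n) → ℝ, MemFracSobolev h q U f →
    MemLp f (ENNReal.ofReal r) (volume.restrict U)) ∧
  (∃ C : ℝ≥0, ∀ f : EuclideanSpace ℝ (Fin n) → ℝ, MemFracSobolev h q U f →
    eLpNorm f (ENNReal.ofReal r) (volume.restrict U) ≤ C * fracSobolevNorm h q U f) ∧
  (∀ (f : ℕ → EuclideanSpace ℝ (Fin n) → ℝ) (M : ℝ≥0),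
    (∀ j, MemFracSobolev h q U (f j)) → (∀ j, fracSobolevNorm h q U (f j) ≤ M) →
    ∃ g : EuclideanSpace ℝ (Fin n) → ℝ, MemLp g (ENNReal.ofReal r) (volume.restrict U) ∧
      ∃ φ : ℕ → ℕ, StrictMono φ ∧
        Tendsto (fun j => eLpNorm (f (φ j) - g) (ENNReal.ofReal r) (volume.restrict U))
          atTop (𝓝 0))

/-! The proof has two independent halves: a subcritical Sobolev inequality, and almost everywhere
convergence of a subsequence. Vitali's theorem joins them. Neither half uses convexity or duality,
so `q < 1` needs no separate treatment.

Sobolev inequality. A bounded Lipschitz domain has measure density: `U ∩ ball x ρ` has volume at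
least `c ρ ^ n` for small `ρ` (`IsLipschitzDomain.exists_measure_density`). If `{|f| > t}` fills at
most half of that volume, each point of `{|f| > 2t}` sees the other half at distance less than `ρ`,
with a jump of at least `t`. The energy thus bounds the volume of `{|f| > 2t}`
(`measure_superlevel_mul_le_gagliardoEnergy`). Iterating over dyadic levels gives decay `2 ^ (-s k)`
with `s = nq / (n - hq)`, and summing the layers bounds the `L^r` integral for every `r < s`
(`exists_lintegral_rpow_le`).

Almost everywhere convergence. Functions in the space need not be integrable, so `arctan ∘ f` is
used instead. On a small ball the energy forces `f` close to one of its values, so `arctan ∘ f` is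
`L¹`-close to step functions on finitely many balls that do not depend on `f`
(`exists_step_approx`). Hence bounded sequences become totally bounded in `L¹`. Fatou keeps the
limit of `arctan ∘ f j` inside `(-π/2, π/2)`, and `tan` recovers a limit of `f j`
(`exists_subseq_tendsto_ae`). -/

/-! ### Geometry of Lipschitz domains: corkscrew balls and measure density. -/

/-- Interior corkscrew condition for bounded Lipschitz domains. -/
theorem IsLipschitzDomain.exists_ball_subset {n : ℕ} {U : Set (EuclideanSpace ℝ (Fin n))}
    (hU : IsLipschitzDomain U) (hUb : Bornology.IsBounded U) :
    ∃ κ : ℝ, 0 < κ ∧ ∃ R : ℝ, 0 < R ∧ ∀ x ∈ U, ∀ ρ : ℝ, 0 < ρ → ρ ≤ R →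
      ∃ y, Metric.ball y (κ * ρ) ⊆ U ∩ Metric.ball x ρ := by
  obtain ⟨hUo, -, hloc⟩ := hU
  -- Relative to `s` the property is stable under subsets and finite unions, so compactness of the
  -- closure reduces it to a neighbourhood of one point.
  let P : Set (EuclideanSpace ℝ (Fin n)) → Prop := fun s =>
    ∃ κ : ℝ, 0 < κ ∧ ∃ R : ℝ, 0 < R ∧ ∀ x ∈ s ∩ U, ∀ ρ : ℝ, 0 < ρ → ρ ≤ R →
      ∃ y, Metric.ball y (κ * ρ) ⊆ U ∩ Metric.ball x ρ
  have key : P (closure U) := by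
    refine IsCompact.induction_on (p := P) hUb.isCompact_closure ?_ ?_ ?_ ?_
    · exact ⟨1, one_pos, 1, one_pos, by simp⟩
    · rintro s t hst ⟨κ, hκ, R, hR, H⟩
      exact ⟨κ, hκ, R, hR, fun x hx => H x ⟨hst hx.1, hx.2⟩⟩
    · rintro s t ⟨κ, hκ, R, hR, H⟩ ⟨κ', hκ', R', hR', H'⟩
      refine ⟨min κ κ', lt_min hκ hκ', min R R', lt_min hR hR', ?_⟩
      rintro x ⟨hx | hx, hxU⟩ ρ hρ hρR
      · obtain ⟨y, hy⟩ := H x ⟨hx, hxU⟩ ρ hρ (hρR.trans (min_le_left _ _))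
        exact ⟨y, (Metric.ball_subset_ball
          (mul_le_mul_of_nonneg_right (min_le_left _ _) hρ.le)).trans hy⟩
      · obtain ⟨y, hy⟩ := H' x ⟨hx, hxU⟩ ρ hρ (hρR.trans (min_le_right _ _))
        exact ⟨y, (Metric.ball_subset_ball
          (mul_le_mul_of_nonneg_right (min_le_right _ _) hρ.le)).trans hy⟩
    · intro x₀ hx₀
      by_cases hxU : x₀ ∈ U
      · obtain ⟨s, hs, hsU⟩ := Metric.isOpen_iff.1 hUo x₀ hxU
        refine ⟨Metric.ball x₀ (s / 2), mem_nhdsWithin_of_mem_nhds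
          (Metric.ball_mem_nhds _ (half_pos hs)), 1, one_pos, s / 2, half_pos hs, ?_⟩
        rintro x ⟨hx, -⟩ ρ hρ hρs
        refine ⟨x, ?_⟩
        rw [one_mul]
        refine Set.subset_inter (Set.Subset.trans ?_ hsU) subset_rfl
        refine Metric.ball_subset_ball' ?_
        have := Metric.mem_ball.1 hx
        linarith
      · have hfr : x₀ ∈ frontier U := by
          rw [hUo.frontier_eq]; exact ⟨hx₀, hxU⟩
        obtain ⟨r, hr, e, he, K, γ, hγ, H⟩ := hloc x₀ hfr
        have hK : (0 : ℝ) ≤ K := K.2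
        -- The centre is `x` lifted by `ρ / 2` along `e`. A perturbation `w` lowers the height by at
        -- most `‖w‖` and raises the graph by at most `2K‖w‖`, so `(2K + 1)‖w‖ < ρ / 2` keeps the
        -- point in `U`.
        refine ⟨Metric.ball x₀ (r / 2), mem_nhdsWithin_of_mem_nhds
          (Metric.ball_mem_nhds _ (half_pos hr)), 1 / (2 * (2 * K + 1)), by positivity,
          r / 2, half_pos hr, ?_⟩
        rintro x ⟨hx, hxU'⟩ ρ hρ hρr
        have hxr := Metric.mem_ball.1 hx
        refine ⟨x + (ρ / 2) • e, fun z hz => ?_⟩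
        obtain ⟨w, rfl⟩ : ∃ w, z = x + (ρ / 2) • e + w := ⟨z - (x + (ρ / 2) • e), by abel⟩
        have hw : ‖w‖ * (2 * K + 1) < ρ / 2 := by
          rw [Metric.mem_ball, dist_eq_norm, add_sub_cancel_left] at hz
          have h2 : (0:ℝ) < 2 * K + 1 := by positivity
          calc ‖w‖ * (2 * K + 1) < 1 / (2 * (2 * K + 1)) * ρ * (2 * K + 1) := by gcongr
            _ = ρ / 2 := by field_simp
        have hw0 := norm_nonneg w
        have hKw : 0 ≤ ‖w‖ * K := by positivity
        have hdist : dist (x + (ρ / 2) • e + w) x < ρ := by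
          rw [dist_eq_norm, show x + (ρ / 2) • e + w - x = (ρ / 2) • e + w by abel]
          calc ‖(ρ / 2) • e + w‖ ≤ ‖(ρ / 2) • e‖ + ‖w‖ := norm_add_le _ _
            _ = ρ / 2 + ‖w‖ := by
              rw [norm_smul, he, mul_one, Real.norm_of_nonneg (by positivity)]
            _ < ρ := by nlinarith
        have hin : inner ℝ e (x + (ρ / 2) • e + w) = inner ℝ e x + ρ / 2 + inner ℝ e w := by
          rw [inner_add_right, inner_add_right, inner_smul_right, real_inner_self_eq_norm_sq, he]
          ring
        have hinw : |inner ℝ e w| ≤ ‖w‖ := by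
          simpa [he] using abs_real_inner_le_norm e w
        have hzr : x + (ρ / 2) • e + w ∈ Metric.ball x₀ r := by
          rw [Metric.mem_ball]
          have := dist_triangle (x + (ρ / 2) • e + w) x x₀
          linarith
        have hx' : x ∈ Metric.ball x₀ r := by rw [Metric.mem_ball]; linarith
        refine ⟨(H _ hzr).2 ?_, hdist⟩
        have h1 := (H _ hx').1 hxU'
        have h2 : γ (x + (ρ / 2) • e + w - inner ℝ e (x + (ρ / 2) • e + w) • e) ≤
            γ (x - inner ℝ e x • e) + K * (2 * ‖w‖) := by
          have h3 := hγ.dist_le_mul (x + (ρ / 2) • e + w - inner ℝ e (x + (ρ / 2) • e + w) • e)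
            (x - inner ℝ e x • e)
          have h4 : dist (x + (ρ / 2) • e + w - inner ℝ e (x + (ρ / 2) • e + w) • e)
            (x - inner ℝ e x • e) ≤ 2 * ‖w‖ := by
            rw [dist_eq_norm, hin, show x + (ρ / 2) • e + w - (inner ℝ e x + ρ / 2 + inner ℝ e w) • e
              - (x - inner ℝ e x • e) = w - (inner ℝ e w) • e by module]
            calc _ ≤ ‖w‖ + ‖(inner ℝ e w) • e‖ := norm_sub_le _ _
              _ ≤ ‖w‖ + ‖w‖ := by
                rw [norm_smul, he, mul_one, Real.norm_eq_abs]; gcongr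
              _ = _ := by ring
          rw [Real.dist_eq] at h3
          have h5 := (abs_le.1 (h3.trans (mul_le_mul_of_nonneg_left h4 hK))).2
          linarith
        rw [hin] at h2 ⊢
        have := (abs_le.1 hinw).1
        nlinarith
  obtain ⟨κ, hκ, R, hR, H⟩ := key
  exact ⟨κ, hκ, R, hR, fun x hx => H x ⟨subset_closure hx, hx⟩⟩

/-- Measure density condition for bounded Lipschitz domains. -/
theorem IsLipschitzDomain.exists_measure_density {n : ℕ} {U : Set (EuclideanSpace ℝ (Fin n))}
    (hU : IsLipschitzDomain U) (hUb : Bornology.IsBounded U) :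
    ∃ c : ℝ, 0 < c ∧ ∃ R : ℝ, 0 < R ∧ ∀ x ∈ U, ∀ ρ : ℝ, 0 < ρ → ρ ≤ R →
      ENNReal.ofReal (c * ρ ^ n) ≤ volume (U ∩ Metric.ball x ρ) := by
  obtain ⟨κ, hκ, R, hR, H⟩ := hU.exists_ball_subset hUb
  set v := (volume (Metric.ball (0 : EuclideanSpace ℝ (Fin n)) 1)).toReal with hv
  have hfin : volume (Metric.ball (0 : EuclideanSpace ℝ (Fin n)) 1) ≠ ∞ :=
    measure_ball_lt_top.ne
  have hvpos : 0 < v := ENNReal.toReal_pos (Metric.measure_ball_pos _ _ one_pos).ne' hfin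
  refine ⟨κ ^ n * v, by positivity, R, hR, fun x hx ρ hρ hρR => ?_⟩
  obtain ⟨y, hy⟩ := H x hx ρ hρ hρR
  refine le_trans (le_of_eq ?_) (measure_mono hy)
  rw [Measure.addHaar_ball_of_pos _ _ (by positivity : 0 < κ * ρ), finrank_euclideanSpace,
    Fintype.card_fin, ← ENNReal.ofReal_toReal hfin, ← hv, ← ENNReal.ofReal_mul (by positivity)]
  congr 1
  ring

/-! ### Gagliardo energy: invariance and scaling. -/

/-- The Gagliardo energy, the second summand in `fracSobolevNorm`. -/
noncomputable def gagliardoEnergy {n : ℕ} (h q : ℝ) (U : Set (EuclideanSpace ℝ (Fin n)))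
    (f : EuclideanSpace ℝ (Fin n) → ℝ) : ℝ≥0∞ :=
  ∫⁻ y in U, ∫⁻ x in U, ‖f x - f y‖ₑ ^ q / ‖x - y‖ₑ ^ ((n : ℝ) + h * q)

theorem gagliardoEnergy_congr {n : ℕ} {h q : ℝ} {U : Set (EuclideanSpace ℝ (Fin n))}
    {f g : EuclideanSpace ℝ (Fin n) → ℝ} (hfg : f =ᵐ[volume.restrict U] g) :
    gagliardoEnergy h q U f = gagliardoEnergy h q U g := by
  refine lintegral_congr_ae ?_
  filter_upwards [hfg] with y hy
  refine lintegral_congr_ae ?_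
  filter_upwards [hfg] with x hx
  rw [hx, hy]

theorem enorm_const_mul_rpow (l q a : ℝ) (hl : 0 < l) (hq : 0 < q) :
    ‖l * a‖ₑ ^ q = ENNReal.ofReal (l ^ q) * ‖a‖ₑ ^ q := by
  rw [enorm_mul, ENNReal.mul_rpow_of_nonneg _ _ hq.le, Real.enorm_eq_ofReal hl.le,
    ENNReal.ofReal_rpow_of_pos hl]

theorem gagliardoEnergy_const_mul {n : ℕ} {h q l : ℝ} {U : Set (EuclideanSpace ℝ (Fin n))}
    (f : EuclideanSpace ℝ (Fin n) → ℝ) (hl : 0 < l) (hq : 0 < q) :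
    gagliardoEnergy h q U (fun x => l * f x) =
      ENNReal.ofReal (l ^ q) * gagliardoEnergy h q U f := by
  unfold gagliardoEnergy
  rw [← lintegral_const_mul' _ _ ENNReal.ofReal_ne_top]
  refine lintegral_congr fun y => ?_
  rw [← lintegral_const_mul' _ _ ENNReal.ofReal_ne_top]
  refine lintegral_congr fun x => ?_
  rw [← mul_sub, enorm_const_mul_rpow _ _ _ hl hq, mul_div_assoc]

theorem lintegral_const_mul_rpow_enorm {α : Type*} [MeasurableSpace α] {μ : Measure α} {q l : ℝ}
    (f : α → ℝ) (hl : 0 < l) (hq : 0 < q) :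
    ∫⁻ x, ‖l * f x‖ₑ ^ q ∂μ = ENNReal.ofReal (l ^ q) * ∫⁻ x, ‖f x‖ₑ ^ q ∂μ := by
  rw [← lintegral_const_mul' _ _ ENNReal.ofReal_ne_top]
  exact lintegral_congr fun x => enorm_const_mul_rpow _ _ _ hl hq

/-! ### Decay of superlevel sets and the Sobolev inequality on the unit ball. -/

/-- Points of a superlevel set interact with the complement of a lower superlevel set. -/
theorem measure_superlevel_mul_le_gagliardoEnergy {n : ℕ} {h q : ℝ}
    {U : Set (EuclideanSpace ℝ (Fin n))} {f : EuclideanSpace ℝ (Fin n) → ℝ}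
    (hU : MeasurableSet U) (hf : Measurable f) (hq : 0 < q) (hh : 0 < h)
    {ρ α t : ℝ} (hρ : 0 < ρ) (hα : 0 ≤ α) (ht : 0 < t)
    (hball : ∀ y ∈ U, ENNReal.ofReal (2 * α) ≤ volume (U ∩ Metric.ball y ρ))
    (hlev : volume (U ∩ {x | t < |f x|}) ≤ ENNReal.ofReal α) :
    volume (U ∩ {x | 2 * t < |f x|}) *
      ENNReal.ofReal (t ^ q / ρ ^ ((n : ℝ) + h * q) * α) ≤ gagliardoEnergy h q U f := by
  have hm : ∀ t : ℝ, MeasurableSet {x | t < |f x|} := fun t =>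
    measurableSet_lt measurable_const hf.abs
  have hp : 0 < (n : ℝ) + h * q := by positivity
  set p := (n : ℝ) + h * q with hpdef
  have hinner : ∀ y ∈ U ∩ {x | 2 * t < |f x|}, ENNReal.ofReal (t ^ q / ρ ^ p * α) ≤
      ∫⁻ x in U, ‖f x - f y‖ₑ ^ q / ‖x - y‖ₑ ^ p := by
    rintro y ⟨hyU, hy⟩
    -- The ball carries mass at least `2α` and the level set at most `α`, so `V` keeps at least `α`.
    -- On `V` the jump is at least `t` and the distance at most `ρ`.
    set V := (U ∩ Metric.ball y ρ) \ {x | t < |f x|} with hV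
    have hVm : MeasurableSet V := (hU.inter measurableSet_ball).diff (hm t)
    have hVvol : ENNReal.ofReal α ≤ volume V := by
      have h1 : volume ((U ∩ Metric.ball y ρ) ∩ {x | t < |f x|}) ≤ ENNReal.ofReal α :=
        (measure_mono (by intro x hx; exact ⟨hx.1.1, hx.2⟩)).trans hlev
      have h2 := measure_inter_add_sdiff (μ := volume) (U ∩ Metric.ball y ρ) (hm t)
      have h3 := hball y hyU
      rw [← h2, two_mul, ENNReal.ofReal_add hα hα] at h3
      exact (ENNReal.add_le_add_iff_left (a := ENNReal.ofReal α) ENNReal.ofReal_ne_top).1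
        (h3.trans (by gcongr))
    calc ENNReal.ofReal (t ^ q / ρ ^ p * α)
        = ENNReal.ofReal (t ^ q / ρ ^ p) * ENNReal.ofReal α := by
          rw [ENNReal.ofReal_mul (by positivity)]
      _ ≤ ENNReal.ofReal (t ^ q / ρ ^ p) * volume V := by gcongr
      _ = ∫⁻ x in V, ENNReal.ofReal (t ^ q / ρ ^ p) := by rw [setLIntegral_const]
      _ ≤ ∫⁻ x in V, ‖f x - f y‖ₑ ^ q / ‖x - y‖ₑ ^ p := by
          refine setLIntegral_mono' hVm fun x hx => ?_
          rw [ENNReal.ofReal_div_of_pos (by positivity), ← ENNReal.ofReal_rpow_of_pos ht,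
            ← ENNReal.ofReal_rpow_of_pos hρ]
          have hxt : |f x| ≤ t := not_lt.1 hx.2
          have hyt : 2 * t < |f y| := hy
          refine ENNReal.div_le_div (ENNReal.rpow_le_rpow ?_ hq.le)
            (ENNReal.rpow_le_rpow ?_ hp.le)
          · rw [← ofReal_norm, Real.norm_eq_abs]
            refine ENNReal.ofReal_le_ofReal ?_
            have := abs_sub_abs_le_abs_sub (f y) (f x)
            rw [abs_sub_comm] at this
            linarith
          · rw [← ofReal_norm]
            refine ENNReal.ofReal_le_ofReal ?_
            have := Metric.mem_ball.1 hx.1.2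
            rw [dist_eq_norm] at this
            exact this.le
      _ ≤ _ := lintegral_mono_set fun x hx => hx.1.1
  calc _ = ∫⁻ y in U ∩ {x | 2 * t < |f x|}, ENNReal.ofReal (t ^ q / ρ ^ p * α) := by
        rw [setLIntegral_const, mul_comm]
    _ ≤ ∫⁻ y in U ∩ {x | 2 * t < |f x|}, ∫⁻ x in U, ‖f x - f y‖ₑ ^ q / ‖x - y‖ₑ ^ p :=
        setLIntegral_mono' (hU.inter (hm _)) hinner
    _ ≤ _ := lintegral_mono_set Set.inter_subset_left

/-- Weak-type bound at the critical exponent `n q / (n - h q)`, along dyadic levels. -/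
theorem exists_measure_superlevel_le {n : ℕ} {h q : ℝ} {U : Set (EuclideanSpace ℝ (Fin n))}
    (hU : MeasurableSet U) (hq : 0 < q) (hh : 0 < h) (hn : h * q < n) {c R : ℝ} (hc : 0 < c)
    (hR : 0 < R) (hdens : ∀ x ∈ U, ∀ ρ : ℝ, 0 < ρ → ρ ≤ R →
      ENNReal.ofReal (c * ρ ^ n) ≤ volume (U ∩ Metric.ball x ρ)) :
    ∃ t₀ : ℝ, 0 < t₀ ∧ ∃ D : ℝ, 0 < D ∧ ∀ f : EuclideanSpace ℝ (Fin n) → ℝ, Measurable f →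
      ∫⁻ x in U, ‖f x‖ₑ ^ q ≤ 1 → gagliardoEnergy h q U f ≤ 1 → ∀ k : ℕ,
        volume (U ∩ {x | 2 ^ k * t₀ < |f x|}) ≤
          ENNReal.ofReal (D * ((2 : ℝ) ^ (-(n * q / (n - h * q)))) ^ k) := by
  have hn0 : (0 : ℝ) < n := lt_trans (by positivity) hn
  have hnq : 0 < (n : ℝ) - h * q := by linarith
  set s : ℝ := n * q / (n - h * q) with hs
  have hs0 : 0 < s := by positivity
  set p : ℝ := (n : ℝ) + h * q with hp
  set D : ℝ := c * R ^ n / 2 with hD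
  have hD0 : 0 < D := by positivity
  -- `A` will be `t₀ ^ q`. The first entry makes Chebyshev give the bound `D` at level `t₀`; the
  -- second closes the induction step.
  set A : ℝ := max (1 / D) (2 ^ s * R ^ p / D ^ 2) with hA
  have hA0 : 0 < A := lt_max_of_lt_left (by positivity)
  set t₀ : ℝ := A ^ (1 / q) with ht₀
  have ht₀pos : 0 < t₀ := by positivity
  have ht₀q : t₀ ^ q = A := by
    rw [ht₀, ← Real.rpow_mul hA0.le, one_div_mul_cancel hq.ne', Real.rpow_one]
  refine ⟨t₀, ht₀pos, D, hD0, fun f hf hfq hfE k => ?_⟩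
  induction k with
  | zero =>
    have h1 : ENNReal.ofReal A * volume (U ∩ {x | 2 ^ 0 * t₀ < |f x|}) ≤ 1 := by
      calc _ = ∫⁻ x in U ∩ {x | 2 ^ 0 * t₀ < |f x|}, ENNReal.ofReal A := by
            rw [setLIntegral_const]
        _ ≤ ∫⁻ x in U ∩ {x | 2 ^ 0 * t₀ < |f x|}, ‖f x‖ₑ ^ q := by
            refine setLIntegral_mono' (hU.inter (measurableSet_lt measurable_const hf.abs)) ?_
            rintro x ⟨-, hx⟩
            rw [Set.mem_ofPred_eq, pow_zero, one_mul] at hx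
            rw [← ht₀q, ← ENNReal.ofReal_rpow_of_pos ht₀pos, ← ofReal_norm,
              Real.norm_eq_abs]
            exact ENNReal.rpow_le_rpow (ENNReal.ofReal_le_ofReal hx.le) hq.le
        _ ≤ ∫⁻ x in U, ‖f x‖ₑ ^ q := lintegral_mono_set Set.inter_subset_left
        _ ≤ 1 := hfq
    rw [pow_zero ((2 : ℝ) ^ (-s)), mul_one]
    have hAD : 1 / D ≤ A := le_max_left _ _
    calc volume (U ∩ {x | 2 ^ 0 * t₀ < |f x|})
        ≤ (ENNReal.ofReal A)⁻¹ := by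
          rw [← one_div, ENNReal.le_div_iff_mul_le (Or.inr one_ne_zero) (Or.inr ENNReal.one_ne_top),
            mul_comm]
          exact h1
      _ = ENNReal.ofReal A⁻¹ := by rw [ENNReal.ofReal_inv_of_pos hA0]
      _ ≤ ENNReal.ofReal D := by
          refine ENNReal.ofReal_le_ofReal ?_
          rw [inv_le_comm₀ hA0 hD0, ← one_div]
          exact hAD
  | succ k ih =>
    set b : ℝ := ((2 : ℝ) ^ (-s)) ^ k with hb
    have hb0 : 0 < b := by positivity
    have hb1 : b ≤ 1 := pow_le_one₀ (by positivity)
      (Real.rpow_le_one_of_one_le_of_nonpos one_le_two (by linarith))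
    -- Chosen so that `c ρ ^ n` is exactly twice the inductive bound `D b`; `b ≤ 1` keeps `ρ ≤ R`.
    set ρ : ℝ := R * b ^ (1 / (n : ℝ)) with hρ
    have hρ0 : 0 < ρ := by positivity
    have hρR : ρ ≤ R := mul_le_of_le_one_right hR.le
      (Real.rpow_le_one hb0.le hb1 (by positivity))
    have hρn : c * ρ ^ n = 2 * (D * b) := by
      rw [hρ, mul_pow, ← Real.rpow_natCast (b ^ (1 / (n : ℝ))) n, ← Real.rpow_mul hb0.le,
        one_div_mul_cancel hn0.ne', Real.rpow_one, hD]
      ring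
    have key := measure_superlevel_mul_le_gagliardoEnergy (h := h) hU hf hq hh hρ0
      (by positivity : 0 ≤ D * b) (by positivity : 0 < 2 ^ k * t₀)
      (fun y hy => hρn ▸ hdens y hy ρ hρ0 hρR) ih
    rw [← mul_assoc, ← pow_succ'] at key
    set X : ℝ := (2 ^ k * t₀) ^ q / ρ ^ p * (D * b) with hX
    have hX0 : 0 < X := by positivity
    have hval : 1 ≤ D * ((2 : ℝ) ^ (-s)) ^ (k + 1) * X := by
      have e1 : (2 ^ k * t₀) ^ q = ((2 : ℝ) ^ q) ^ k * A := by
        rw [Real.mul_rpow (by positivity) ht₀pos.le, ht₀q, ← Real.rpow_natCast, ← Real.rpow_mul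
          two_pos.le, mul_comm (k : ℝ) q, Real.rpow_mul two_pos.le, Real.rpow_natCast]
      have e2 : ρ ^ p = R ^ p * b ^ (p / n) := by
        rw [hρ, Real.mul_rpow hR.le (by positivity), ← Real.rpow_mul hb0.le, one_div_mul_eq_div]
      -- Criticality of `s`: this identity amounts to `s (n - hq) = nq`. It makes all powers of `k`
      -- cancel, so `D` does not deteriorate along the induction.
      have e3 : b ^ (p / n) = b ^ 2 * ((2 : ℝ) ^ q) ^ k := by
        rw [hb, ← Real.rpow_natCast, ← Real.rpow_natCast, ← Real.rpow_natCast,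
          ← Real.rpow_mul two_pos.le, ← Real.rpow_mul two_pos.le, ← Real.rpow_mul two_pos.le,
          ← Real.rpow_mul two_pos.le, ← Real.rpow_add two_pos]
        congr 1
        have hsm : s * (n - h * q) = n * q := div_mul_cancel₀ _ hnq.ne'
        rw [hp, mul_div_assoc', ← sub_eq_zero, div_sub' hn0.ne', div_eq_zero_iff]
        left
        push_cast
        linear_combination (k : ℝ) * hsm
      have hAge : 2 ^ s * R ^ p / D ^ 2 ≤ A := le_max_right _ _
      have e4 : D * ((2 : ℝ) ^ (-s)) ^ (k + 1) * X = A * D ^ 2 / (2 ^ s * R ^ p) := by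
        rw [hX, e1, e2, e3, pow_succ, ← hb, Real.rpow_neg two_pos.le]
        field_simp
      rw [e4, le_div_iff₀ (by positivity), one_mul]
      rwa [div_le_iff₀ (by positivity)] at hAge
    have hXne : ENNReal.ofReal X ≠ 0 := (ENNReal.ofReal_pos.2 hX0).ne'
    calc volume (U ∩ {x | 2 ^ (k + 1) * t₀ < |f x|})
        ≤ 1 / ENNReal.ofReal X := by
          rw [ENNReal.le_div_iff_mul_le (Or.inl hXne) (Or.inl ENNReal.ofReal_ne_top)]
          exact key.trans hfE
      _ = ENNReal.ofReal (1 / X) := by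
          rw [ENNReal.ofReal_div_of_pos hX0, ENNReal.ofReal_one]
      _ ≤ _ := by
          refine ENNReal.ofReal_le_ofReal ?_
          rwa [div_le_iff₀ hX0]

/-- Layered domination of a power by its dyadic superlevel sets. -/
theorem rpow_enorm_le_add_tsum {α : Type*} (f : α → ℝ) {r t₀ : ℝ} (hr : 0 < r) (ht : 0 < t₀)
    (x : α) :
    ‖f x‖ₑ ^ r ≤ ENNReal.ofReal (t₀ ^ r) +
      ∑' k : ℕ, {x | 2 ^ k * t₀ < |f x|}.indicator
        (fun _ => ENNReal.ofReal ((2 ^ (k + 1) * t₀) ^ r)) x := by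
  have conv : ∀ a : ℝ, 0 < a → |f x| ≤ a → ‖f x‖ₑ ^ r ≤ ENNReal.ofReal (a ^ r) := by
    intro a ha hfa
    rw [← ENNReal.ofReal_rpow_of_pos ha, ← ofReal_norm, Real.norm_eq_abs]
    exact ENNReal.rpow_le_rpow (ENNReal.ofReal_le_ofReal hfa) hr.le
  have hex : ∃ k : ℕ, |f x| ≤ 2 ^ k * t₀ := by
    obtain ⟨k, hk⟩ := pow_unbounded_of_one_lt (|f x| / t₀) one_lt_two
    exact ⟨k, ((div_lt_iff₀ ht).1 hk).le⟩
  classical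
  rcases hk : Nat.find hex with _ | k
  · have h0 := Nat.find_spec hex
    rw [hk, pow_zero, one_mul] at h0
    exact (conv _ ht h0).trans le_self_add
  · have h0 := Nat.find_spec hex
    rw [hk] at h0
    have h1 : 2 ^ k * t₀ < |f x| := not_le.1 (Nat.find_min hex (by omega : k < Nat.find hex))
    refine (conv _ (by positivity) h0).trans (le_trans ?_ le_add_self)
    refine le_trans (le_of_eq ?_) (ENNReal.le_tsum k)
    rw [Set.indicator_of_mem (by exact h1)]

/-- Subcritical fractional Sobolev inequality on sets with the measure density condition, for
functions in the unit ball. -/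
theorem exists_lintegral_rpow_le {n : ℕ} {h q : ℝ} {U : Set (EuclideanSpace ℝ (Fin n))}
    (hU : MeasurableSet U) (hUfin : volume U ≠ ∞)
    (hq : 0 < q) (hh : 0 < h) (hn : h * q < n) {c R : ℝ} (hc : 0 < c)
    (hR : 0 < R) (hdens : ∀ x ∈ U, ∀ ρ : ℝ, 0 < ρ → ρ ≤ R →
      ENNReal.ofReal (c * ρ ^ n) ≤ volume (U ∩ Metric.ball x ρ))
    {r : ℝ} (hr0 : 0 < r) (hr : r < n * q / (n - h * q)) :
    ∃ C : ℝ≥0, ∀ f : EuclideanSpace ℝ (Fin n) → ℝ, AEStronglyMeasurable f (volume.restrict U) →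
      ∫⁻ x in U, ‖f x‖ₑ ^ q ≤ 1 → gagliardoEnergy h q U f ≤ 1 →
        ∫⁻ x in U, ‖f x‖ₑ ^ r ≤ C := by
  obtain ⟨t₀, ht₀, D, hD, H⟩ := exists_measure_superlevel_le hU hq hh hn hc hR hdens
  set s : ℝ := n * q / (n - h * q) with hs
  -- Ratio of the layer series: `(2 ^ (k+1) t₀) ^ r` times `D 2 ^ (-s k)` equals `(2 t₀) ^ r D B ^
  -- k`.
  set B : ℝ := (2 : ℝ) ^ (r - s) with hB
  have hB0 : 0 < B := by positivity
  have hB1 : B < 1 := Real.rpow_lt_one_of_one_lt_of_neg one_lt_two (by linarith)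
  have hsum : ENNReal.ofReal (t₀ ^ r) * volume U +
      ∑' k : ℕ, ENNReal.ofReal ((2 * t₀) ^ r * D * B ^ k) ≠ ∞ := by
    refine ENNReal.add_ne_top.2 ⟨ENNReal.mul_ne_top ENNReal.ofReal_ne_top hUfin, ?_⟩
    exact ((summable_geometric_of_lt_one hB0.le hB1).mul_left _).tsum_ofReal_ne_top
  refine ⟨(ENNReal.ofReal (t₀ ^ r) * volume U +
      ∑' k : ℕ, ENNReal.ofReal ((2 * t₀) ^ r * D * B ^ k)).toNNReal, fun f hf hfq hfE => ?_⟩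
  rw [ENNReal.coe_toNNReal hsum]
  obtain ⟨g, hg, hfg⟩ := hf
  have hgm := hg.measurable
  have hpow : ∀ a : ℝ, ∫⁻ x in U, ‖f x‖ₑ ^ a = ∫⁻ x in U, ‖g x‖ₑ ^ a := fun a =>
    lintegral_congr_ae (by filter_upwards [hfg] with x hx; rw [hx])
  rw [hpow] at hfq ⊢
  rw [gagliardoEnergy_congr hfg] at hfE
  have hlev := H g hgm hfq hfE
  have hm : ∀ t : ℝ, MeasurableSet {x | t < |g x|} := fun t =>
    measurableSet_lt measurable_const hgm.abs
  calc ∫⁻ x in U, ‖g x‖ₑ ^ r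
      ≤ ∫⁻ x in U, (ENNReal.ofReal (t₀ ^ r) +
        ∑' k : ℕ, {x | 2 ^ k * t₀ < |g x|}.indicator
          (fun _ => ENNReal.ofReal ((2 ^ (k + 1) * t₀) ^ r)) x) :=
        lintegral_mono fun x => rpow_enorm_le_add_tsum g hr0 ht₀ x
    _ = ENNReal.ofReal (t₀ ^ r) * volume U + ∑' k : ℕ,
          ENNReal.ofReal ((2 ^ (k + 1) * t₀) ^ r) * volume (U ∩ {x | 2 ^ k * t₀ < |g x|}) := by
        rw [lintegral_add_left measurable_const, setLIntegral_const,
          lintegral_tsum fun k => (measurable_const.indicator (hm _)).aemeasurable]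
        congr 1
        refine tsum_congr fun k => ?_
        rw [lintegral_indicator_const (hm _), Measure.restrict_apply (hm _), Set.inter_comm]
    _ ≤ _ := by
        gcongr with k
        refine (mul_le_mul_right (hlev k) _).trans (le_of_eq ?_)
        rw [← ENNReal.ofReal_mul (by positivity)]
        congr 1
        have e1 : ((2 : ℝ) ^ (k + 1) * t₀) ^ r = (2 * t₀) ^ r * ((2 : ℝ) ^ r) ^ k := by
          rw [pow_succ', mul_right_comm, Real.mul_rpow (by positivity) (by positivity),
            ← Real.rpow_natCast, ← Real.rpow_mul two_pos.le, mul_comm (k : ℝ) r,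
            Real.rpow_mul two_pos.le, Real.rpow_natCast]
        rw [e1, hB, sub_eq_add_neg, Real.rpow_add two_pos, mul_pow]
        ring

/-! ### Bounded truncation by `arctan` and total boundedness in `L¹`. -/

theorem abs_arctan_sub_arctan_le (a b : ℝ) : |Real.arctan a - Real.arctan b| ≤ |a - b| := by
  have h := Convex.norm_image_sub_le_of_norm_deriv_le (𝕜 := ℝ) (f := Real.arctan) (C := 1)
    (s := Set.univ) (x := b) (y := a) (fun x _ => Real.differentiableAt_arctan x) (fun x _ => by
      rw [Real.deriv_arctan, Real.norm_of_nonneg (by positivity), div_le_one (by positivity)]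
      nlinarith [sq_nonneg x]) convex_univ trivial trivial
  simpa using h

theorem abs_arctan_lt_two (a : ℝ) : |Real.arctan a| < 2 := by
  rw [abs_lt]
  constructor <;> linarith [Real.arctan_lt_pi_div_two a, Real.neg_pi_div_two_lt_arctan a,
    Real.pi_lt_four]

/-- Differences up to `δ` are handled by the Lipschitz bound. Beyond `δ` the left side is below `4`,
while `(|a - b| / δ) ^ q ≥ 1`. This turns `q`-th power control into `L¹` control for every `q > 0`.
-/
theorem abs_arctan_sub_arctan_le_add_rpow {q δ : ℝ} (hq : 0 < q) (hδ : 0 < δ) (a b : ℝ) :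
    |Real.arctan a - Real.arctan b| ≤ δ + 4 * δ ^ (-q) * |a - b| ^ q := by
  rcases le_total |a - b| δ with h | h
  · have := abs_arctan_sub_arctan_le a b
    have : 0 ≤ 4 * δ ^ (-q) * |a - b| ^ q := by positivity
    linarith
  · have h1 : 1 ≤ δ ^ (-q) * |a - b| ^ q := by
      rw [Real.rpow_neg hδ.le, ← div_eq_inv_mul, ← Real.div_rpow (abs_nonneg _) hδ.le]
      exact Real.one_le_rpow ((one_le_div hδ).2 h) hq.le
    have h2 := abs_sub (Real.arctan a) (Real.arctan b)
    have := abs_arctan_lt_two a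
    have := abs_arctan_lt_two b
    linarith

theorem enorm_arctan_sub_arctan_le {q δ : ℝ} (hq : 0 < q) (hδ : 0 < δ) (a b : ℝ) :
    ‖Real.arctan a - Real.arctan b‖ₑ ≤
      ENNReal.ofReal δ + ENNReal.ofReal (4 * δ ^ (-q)) * ‖a - b‖ₑ ^ q := by
  rw [← ofReal_norm, ← ofReal_norm, Real.norm_eq_abs, Real.norm_eq_abs,
    ENNReal.ofReal_rpow_of_nonneg (abs_nonneg _) hq.le, ← ENNReal.ofReal_mul (by positivity),
    ← ENNReal.ofReal_add hδ.le (by positivity)]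
  exact ENNReal.ofReal_le_ofReal (abs_arctan_sub_arctan_le_add_rpow hq hδ a b)

/-- An open set of finite volume is exhausted, up to small measure, by finitely many disjoint
closed balls of small radius. -/
theorem IsOpen.exists_finset_disjoint_closedBall {n : ℕ} {U : Set (EuclideanSpace ℝ (Fin n))}
    (hU : IsOpen U) (hUfin : volume U ≠ ∞) {ρ : ℝ} (hρ : 0 < ρ) {η : ℝ≥0∞} (hη : 0 < η) :
    ∃ (t : Finset (EuclideanSpace ℝ (Fin n))) (r : EuclideanSpace ℝ (Fin n) → ℝ),
      (∀ x ∈ t, 0 < r x ∧ r x < ρ ∧ Metric.closedBall x (r x) ⊆ U) ∧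
      (t : Set (EuclideanSpace ℝ (Fin n))).PairwiseDisjoint
        (fun x => Metric.closedBall x (r x)) ∧
      volume (U \ ⋃ x ∈ t, Metric.closedBall x (r x)) ≤ η := by
  obtain ⟨t, r, htc, -, hr, hvol, hdisj⟩ := Besicovitch.exists_disjoint_closedBall_covering_ae
    (volume : Measure (EuclideanSpace ℝ (Fin n)))
    (fun x => {s | Metric.closedBall x s ⊆ U}) U (by
      intro x hx δ hδ
      obtain ⟨s, hs, hsU⟩ := Metric.nhds_basis_closedBall.mem_iff.1 (hU.mem_nhds hx)
      refine ⟨min s (δ / 2), (Metric.closedBall_subset_closedBall (min_le_left _ _)).trans hsU,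
        lt_min hs (half_pos hδ), (min_le_right _ _).trans_lt (half_lt_self hδ)⟩)
    (fun _ => ρ) (fun _ _ => hρ)
  have : Countable t := htc.to_subtype
  have hsum : ∑' x : t, volume (Metric.closedBall (x : EuclideanSpace ℝ (Fin n)) (r x)) ≠ ∞ := by
    rw [← measure_iUnion (f := fun x : t => Metric.closedBall (x : EuclideanSpace ℝ (Fin n)) (r x))
      (fun (x y : t) hxy => hdisj x.2 y.2 (Subtype.coe_injective.ne hxy))
      (fun _ => Metric.isClosed_closedBall.measurableSet)]
    exact ((measure_mono (Set.iUnion_subset fun x : t => (hr x x.2).1)).trans_lt hUfin.lt_top).ne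
  -- The disjoint balls have finite total volume, so a finite subfamily leaves a tail smaller than
  -- `η`.
  obtain ⟨s, hs⟩ := ((ENNReal.tendsto_tsum_compl_atTop_zero hsum).eventually
    (gt_mem_nhds hη)).exists
  refine ⟨s.map (Function.Embedding.subtype _), r, ?_, ?_, ?_⟩
  · intro x hx
    simp only [Finset.mem_map, Function.Embedding.subtype_apply] at hx
    obtain ⟨y, -, rfl⟩ := hx
    have := hr y y.2
    exact ⟨this.2.1, this.2.2, this.1⟩
  · refine hdisj.subset ?_
    intro x hx
    simp only [Finset.coe_map, Function.Embedding.subtype_apply, Set.mem_image] at hx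
    obtain ⟨y, -, rfl⟩ := hx
    exact y.2
  · calc _ ≤ volume ((U \ ⋃ x ∈ t, Metric.closedBall x (r x)) ∪
          ⋃ b : {x // x ∉ s}, Metric.closedBall ((b : t) : EuclideanSpace ℝ (Fin n)) (r b)) := by
          refine measure_mono ?_
          rintro z ⟨hzU, hz⟩
          by_cases hzt : z ∈ ⋃ x ∈ t, Metric.closedBall x (r x)
          · right
            simp only [Set.mem_iUnion] at hzt
            obtain ⟨x, hx, hzx⟩ := hzt
            refine Set.mem_iUnion.2 ⟨⟨⟨x, hx⟩, fun hxs => hz ?_⟩, hzx⟩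
            simp only [Set.mem_iUnion]
            exact ⟨x, Finset.mem_map.2 ⟨⟨x, hx⟩, hxs, rfl⟩, hzx⟩
          · exact Or.inl ⟨hzU, hzt⟩
      _ ≤ 0 + ∑' b : {x // x ∉ s},
          volume (Metric.closedBall ((b : t) : EuclideanSpace ℝ (Fin n)) (r b)) :=
          (measure_union_le _ _).trans (add_le_add hvol.le (measure_iUnion_le _))
      _ ≤ η := by rw [zero_add]; exact hs.le

/-- Fractional Poincaré inequality on balls, with a well-chosen value of the function. -/
theorem exists_setLIntegral_closedBall_le {n : ℕ} {h q : ℝ} (hq : 0 < q) (hh : 0 < h) :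
    ∃ K : ℝ, 0 < K ∧ ∀ f : EuclideanSpace ℝ (Fin n) → ℝ, Measurable f →
      ∀ (x : EuclideanSpace ℝ (Fin n)) (r : ℝ), 0 < r →
        ∃ y, ∫⁻ z in Metric.closedBall x r, ‖f z - f y‖ₑ ^ q ≤
          ENNReal.ofReal (K * r ^ (h * q)) * ∫⁻ y in Metric.closedBall x r,
            ∫⁻ z in Metric.closedBall x r, ‖f z - f y‖ₑ ^ q / ‖z - y‖ₑ ^ ((n : ℝ) + h * q) := by
  set v := (volume (Metric.ball (0 : EuclideanSpace ℝ (Fin n)) 1)).toReal with hv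
  have hfin : volume (Metric.ball (0 : EuclideanSpace ℝ (Fin n)) 1) ≠ ∞ :=
    measure_ball_lt_top.ne
  have hvpos : 0 < v := ENNReal.toReal_pos (Metric.measure_ball_pos _ _ one_pos).ne' hfin
  set p : ℝ := (n : ℝ) + h * q with hp
  have hp0 : 0 < p := by positivity
  refine ⟨2 ^ p / v, by positivity, fun f hf x r hr => ?_⟩
  set B := Metric.closedBall x r with hB
  have hBvol : volume B = ENNReal.ofReal (r ^ n * v) := by
    rw [hB, Measure.addHaar_closedBall _ _ hr.le, finrank_euclideanSpace, Fintype.card_fin,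
      ENNReal.ofReal_mul (by positivity), hv, ENNReal.ofReal_toReal hfin]
  have hpos : 0 < r ^ n * v := by positivity
  have hmeas : Measurable fun y => ∫⁻ z in B, ‖f z - f y‖ₑ ^ q := by
    refine Measurable.lintegral_prod_right' (f := fun yz : EuclideanSpace ℝ (Fin n) ×
      EuclideanSpace ℝ (Fin n) => ‖f yz.2 - f yz.1‖ₑ ^ q) ?_
    fun_prop
  -- A value `f y` at which the integral is at most its average replaces the mean of `f`, which need
  -- not exist.
  obtain ⟨y, -, hy⟩ := exists_le_setLAverage (μ := volume) (s := B)
    (by rw [hBvol]; exact (ENNReal.ofReal_pos.2 hpos).ne')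
    (by rw [hBvol]; exact ENNReal.ofReal_ne_top) hmeas.aemeasurable
  refine ⟨y, hy.trans ?_⟩
  rw [setLAverage_eq, hBvol]
  -- On the ball `‖z - a‖ ≤ 2r`, so the weight costs `(2r) ^ p`; dividing by the volume `r ^ n v`
  -- leaves `r ^ (h q)`.
  have hmain : ∫⁻ y in B, ∫⁻ z in B, ‖f z - f y‖ₑ ^ q ≤ ENNReal.ofReal ((2 * r) ^ p) *
      ∫⁻ y in B, ∫⁻ z in B, ‖f z - f y‖ₑ ^ q / ‖z - y‖ₑ ^ p := by
    have hBm : MeasurableSet B := Metric.isClosed_closedBall.measurableSet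
    rw [← lintegral_const_mul' _ _ ENNReal.ofReal_ne_top]
    refine setLIntegral_mono' hBm fun a ha => ?_
    rw [← lintegral_const_mul' _ _ ENNReal.ofReal_ne_top]
    refine setLIntegral_mono' hBm fun z hz => ?_
    rcases eq_or_ne z a with rfl | hza
    · simp [hq]
    · have h1 : ‖z - a‖ₑ ^ p ≤ ENNReal.ofReal ((2 * r) ^ p) := by
        rw [← ENNReal.ofReal_rpow_of_pos (by positivity), ← ofReal_norm, ← dist_eq_norm]
        refine ENNReal.rpow_le_rpow (ENNReal.ofReal_le_ofReal ?_) hp0.le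
        have h2 := Metric.mem_closedBall.1 hz
        have h3 := Metric.mem_closedBall.1 ha
        have h4 := dist_triangle_right z a x
        linarith
      have h0 : ‖z - a‖ₑ ≠ 0 := by simpa [sub_eq_zero] using hza
      have hne0 : ‖z - a‖ₑ ^ p ≠ 0 := by
        rw [Ne, ENNReal.rpow_eq_zero_iff_of_pos hp0]; exact h0
      have hnet : ‖z - a‖ₑ ^ p ≠ ∞ := ENNReal.rpow_ne_top_of_nonneg hp0.le enorm_ne_top
      calc ‖f z - f a‖ₑ ^ q = ‖z - a‖ₑ ^ p * (‖f z - f a‖ₑ ^ q / ‖z - a‖ₑ ^ p) := by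
            rw [ENNReal.mul_div_cancel hne0 hnet]
        _ ≤ _ := by gcongr
  calc _ ≤ (ENNReal.ofReal ((2 * r) ^ p) *
        ∫⁻ y in B, ∫⁻ z in B, ‖f z - f y‖ₑ ^ q / ‖z - y‖ₑ ^ p) / ENNReal.ofReal (r ^ n * v) := by
        gcongr
    _ = _ := by
        rw [div_eq_mul_inv, mul_right_comm, ← div_eq_mul_inv,
          ← ENNReal.ofReal_div_of_pos hpos]
        congr 2
        rw [Real.mul_rpow two_pos.le hr.le, hp, Real.rpow_add hr, Real.rpow_natCast]
        field_simp

/-- Approximation of `arctan ∘ f` by functions that are constant on finitely many given balls. -/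
theorem exists_step_approx {n : ℕ} {h q : ℝ} (hq : 0 < q) (hh : 0 < h)
    {U : Set (EuclideanSpace ℝ (Fin n))} (hU : IsOpen U) (hUfin : volume U ≠ ∞)
    {M ε : ℝ} (hM : 0 ≤ M) (hε : 0 < ε) :
    ∃ (t : Finset (EuclideanSpace ℝ (Fin n))) (B : EuclideanSpace ℝ (Fin n) →
      Set (EuclideanSpace ℝ (Fin n))), (∀ x, MeasurableSet (B x)) ∧
      ∀ f : EuclideanSpace ℝ (Fin n) → ℝ, Measurable f →
        gagliardoEnergy h q U f ≤ ENNReal.ofReal M →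
        ∃ c : EuclideanSpace ℝ (Fin n) → ℝ, (∀ x, c x ∈ Set.Icc (-2) 2) ∧
          ∫⁻ z in U, ‖Real.arctan (f z) - ∑ x ∈ t, (B x).indicator (fun _ => c x) z‖ₑ <
            ENNReal.ofReal ε := by
  obtain ⟨K, hK, HK⟩ := exists_setLIntegral_closedBall_le (n := n) hq hh
  set V := (volume U).toReal with hV
  have hV0 : 0 ≤ V := ENNReal.toReal_nonneg
  -- Error budget: `δ V`, the oscillation on the balls, and the uncovered set (volume `ε / 8`,
  -- integrand at most `2`) each cost at most `ε / 4`.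
  set δ : ℝ := ε / (4 * (V + 1)) with hδ
  have hδ0 : 0 < δ := by positivity
  set a : ℝ := 4 * δ ^ (-q) with ha
  have ha0 : 0 < a := by positivity
  have hhq : 0 < h * q := by positivity
  set ρ : ℝ := (ε / (4 * (a * K * M + 1))) ^ (1 / (h * q)) with hρ
  have hρ0 : 0 < ρ := by positivity
  have hρp : ρ ^ (h * q) = ε / (4 * (a * K * M + 1)) := by
    rw [hρ, ← Real.rpow_mul (by positivity), one_div_mul_cancel hhq.ne', Real.rpow_one]
  obtain ⟨t, r, hr, hdisj, hrest⟩ := hU.exists_finset_disjoint_closedBall hUfin hρ0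
    (ENNReal.ofReal_pos.2 (by positivity : 0 < ε / 8))
  have hBm : ∀ x, MeasurableSet (Metric.closedBall x (r x)) := fun x =>
    Metric.isClosed_closedBall.measurableSet
  refine ⟨t, fun x => Metric.closedBall x (r x), hBm, fun f hf hfE => ?_⟩
  -- The inner integral is enlarged to all of `U`, so that summing over the disjoint balls gives at
  -- most the full energy.
  have hy : ∀ x, ∃ y, x ∈ t → ∫⁻ z in Metric.closedBall x (r x), ‖f z - f y‖ₑ ^ q ≤
      ENNReal.ofReal (K * ρ ^ (h * q)) * ∫⁻ y in Metric.closedBall x (r x),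
            ∫⁻ z in U, ‖f z - f y‖ₑ ^ q / ‖z - y‖ₑ ^ ((n : ℝ) + h * q) := by
    intro x
    by_cases hx : x ∈ t
    · obtain ⟨hr0, hrρ, hrU⟩ := hr x hx
      obtain ⟨y, hy⟩ := HK f hf x (r x) hr0
      refine ⟨y, fun _ => hy.trans ?_⟩
      gcongr
    · exact ⟨x, fun h => absurd h hx⟩
  choose y hy using hy
  refine ⟨fun x => Real.arctan (f (y x)), fun x => ?_, ?_⟩
  · have := abs_arctan_lt_two (f (y x))
    rw [abs_lt] at this
    exact ⟨this.1.le, this.2.le⟩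
  set W := U \ ⋃ x ∈ t, Metric.closedBall x (r x) with hW
  have hWm : MeasurableSet W := hU.measurableSet.diff (t.measurableSet_biUnion fun x _ => hBm x)
  have hpt : ∀ z ∈ U, ‖Real.arctan (f z) - ∑ x ∈ t, (Metric.closedBall x (r x)).indicator
      (fun _ => Real.arctan (f (y x))) z‖ₑ ≤ ENNReal.ofReal δ +
        (∑ x ∈ t, (Metric.closedBall x (r x)).indicator
          (fun z => ENNReal.ofReal a * ‖f z - f (y x)‖ₑ ^ q) z + W.indicator (fun _ => 2) z) := by
    intro z hz
    by_cases hzt : ∃ x ∈ t, z ∈ Metric.closedBall x (r x)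
    · obtain ⟨x, hx, hzx⟩ := hzt
      have hsum : ∑ x ∈ t, (Metric.closedBall x (r x)).indicator
          (fun _ => Real.arctan (f (y x))) z = Real.arctan (f (y x)) := by
        rw [Finset.sum_eq_single_of_mem x hx, Set.indicator_of_mem hzx]
        intro x' hx' hne
        exact Set.indicator_of_notMem
          (fun hzx' => (Set.disjoint_left.1 (hdisj hx' hx hne)) hzx' hzx) _
      rw [hsum]
      refine (enorm_arctan_sub_arctan_le hq hδ0 _ _).trans ?_
      gcongr
      refine le_trans (le_trans (le_of_eq ?_) (Finset.single_le_sum (f := fun x =>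
        (Metric.closedBall x (r x)).indicator
          (fun z => ENNReal.ofReal a * ‖f z - f (y x)‖ₑ ^ q) z) (fun _ _ => zero_le) hx))
        le_self_add
      simp only [Set.indicator_of_mem hzx, ha]
    · push Not at hzt
      rw [Finset.sum_eq_zero fun x hx => Set.indicator_of_notMem (hzt x hx) _, sub_zero,
        Set.indicator_of_mem (show z ∈ W from ⟨hz, by simpa using hzt⟩)]
      refine le_trans ?_ (le_add_self.trans le_add_self)
      rw [← ofReal_norm, Real.norm_eq_abs]
      exact (ENNReal.ofReal_le_ofReal (abs_arctan_lt_two _).le).trans (by simp)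
  have hmx : ∀ x, Measurable ((Metric.closedBall x (r x)).indicator
      (fun z => ENNReal.ofReal a * ‖f z - f (y x)‖ₑ ^ q)) := fun x =>
    Measurable.indicator (by fun_prop) (hBm x)
  have hVU : volume U = ENNReal.ofReal V := (ENNReal.ofReal_toReal hUfin).symm
  calc _ ≤ ∫⁻ z in U, (ENNReal.ofReal δ +
        (∑ x ∈ t, (Metric.closedBall x (r x)).indicator
          (fun z => ENNReal.ofReal a * ‖f z - f (y x)‖ₑ ^ q) z + W.indicator (fun _ => 2) z)) :=
        setLIntegral_mono' hU.measurableSet hpt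
    _ = ENNReal.ofReal δ * volume U + ((∑ x ∈ t, ∫⁻ z in U,
          (Metric.closedBall x (r x)).indicator
            (fun z => ENNReal.ofReal a * ‖f z - f (y x)‖ₑ ^ q) z) +
          ∫⁻ z in U, W.indicator (fun _ => 2) z) := by
        rw [lintegral_add_left measurable_const, setLIntegral_const,
          lintegral_add_left (Finset.measurable_fun_sum _ fun x _ => hmx x),
          lintegral_finsetSum _ fun x _ => hmx x]
    _ ≤ ENNReal.ofReal δ * volume U + (∑ x ∈ t, ENNReal.ofReal a *
          (ENNReal.ofReal (K * ρ ^ (h * q)) * ∫⁻ y in Metric.closedBall x (r x),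
            ∫⁻ z in U, ‖f z - f y‖ₑ ^ q / ‖z - y‖ₑ ^ ((n : ℝ) + h * q)) +
          2 * ENNReal.ofReal (ε / 8)) := by
        gcongr with x hx
        · refine (setLIntegral_le_lintegral _ _).trans ?_
          rw [lintegral_indicator (hBm x), lintegral_const_mul' _ _ ENNReal.ofReal_ne_top]
          exact mul_le_mul_right (hy x hx) _
        · refine (setLIntegral_le_lintegral _ _).trans ?_
          rw [lintegral_indicator_const hWm]
          exact mul_le_mul_right hrest _
    _ ≤ ENNReal.ofReal δ * volume U + (ENNReal.ofReal a * (ENNReal.ofReal (K * ρ ^ (h * q)) *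
          ENNReal.ofReal M) + 2 * ENNReal.ofReal (ε / 8)) := by
        rw [← Finset.mul_sum, ← Finset.mul_sum, ← lintegral_biUnion_finset hdisj fun x _ => hBm x]
        gcongr
        refine le_trans (lintegral_mono_set ?_) hfE
        exact Set.iUnion₂_subset fun x hx => (hr x hx).2.2
    _ = ENNReal.ofReal (δ * V + (a * (K * ρ ^ (h * q) * M) + 2 * (ε / 8))) := by
        rw [hVU, ENNReal.ofReal_add (by positivity) (by positivity),
          ENNReal.ofReal_add (by positivity) (by positivity), ENNReal.ofReal_mul hδ0.le,
          ENNReal.ofReal_mul ha0.le, ENNReal.ofReal_mul (p := K * ρ ^ (h * q)) (by positivity),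
          ENNReal.ofReal_mul two_pos.le, ENNReal.ofReal_ofNat]
    _ < ENNReal.ofReal ε := by
        rw [ENNReal.ofReal_lt_ofReal_iff hε]
        have h1 : δ * V ≤ ε / 4 := by
          rw [hδ, div_mul_eq_mul_div, div_le_div_iff₀ (by positivity) (by positivity)]
          nlinarith
        have h2 : a * (K * ρ ^ (h * q) * M) ≤ ε / 4 := by
          have : 0 ≤ a * K * M := by positivity
          rw [show a * (K * ρ ^ (h * q) * M) = ρ ^ (h * q) * (a * K * M) by ring, hρp,
            div_mul_eq_mul_div, div_le_div_iff₀ (by positivity) (by positivity)]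
          nlinarith
        linarith

theorem memLp_step {α : Type*} [MeasurableSpace α] {μ : Measure α} [IsFiniteMeasure μ]
    (t : Finset α) {B : α → Set α} (hB : ∀ x, MeasurableSet (B x)) (c : t → ℝ) :
    MemLp (fun z => ∑ x : t, (B x).indicator (fun _ => c x) z) 1 μ :=
  memLp_finsetSum _ fun x _ => (memLp_const (c x)).indicator (hB x)

/-- Step functions on given sets, as a linear map into `L¹`. -/
noncomputable def stepLp {α : Type*} [MeasurableSpace α] (μ : Measure α) [IsFiniteMeasure μ]
    (t : Finset α) {B : α → Set α} (hB : ∀ x, MeasurableSet (B x)) : (t → ℝ) →ₗ[ℝ] Lp ℝ 1 μ where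
  toFun c := (memLp_step t hB c).toLp _
  map_add' c d := by
    rw [← MemLp.toLp_add]
    congr 1
    ext z
    simp [Set.indicator_add, Finset.sum_add_distrib]
  map_smul' l c := by
    rw [RingHom.id_apply, ← MemLp.toLp_const_smul]
    congr 1
    ext z
    simp [Finset.mul_sum, Set.indicator, mul_ite]

theorem memLp_arctan_comp {α : Type*} [MeasurableSpace α] {μ : Measure α} [IsFiniteMeasure μ]
    {f : α → ℝ} (hf : Measurable f) : MemLp (fun x => Real.arctan (f x)) 1 μ :=
  MemLp.of_bound (Real.measurable_arctan.comp hf).aestronglyMeasurable 2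
    (.of_forall fun x => (abs_arctan_lt_two (f x)).le)

/-- The coefficients of the approximating step functions lie in a cube, whose image under the linear
map `stepLp` is compact. An `ε / 2`-net of that image is an `ε`-net of the range. -/
theorem totallyBounded_range_arctan {n : ℕ} {h q : ℝ} (hq : 0 < q) (hh : 0 < h)
    {U : Set (EuclideanSpace ℝ (Fin n))} (hU : IsOpen U)
    [IsFiniteMeasure (volume.restrict U)] {M : ℝ} (hM : 0 ≤ M)
    {f : ℕ → EuclideanSpace ℝ (Fin n) → ℝ} (hf : ∀ j, Measurable (f j))
    (hfE : ∀ j, gagliardoEnergy h q U (f j) ≤ ENNReal.ofReal M) :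
    TotallyBounded (Set.range fun j =>
      (memLp_arctan_comp (μ := volume.restrict U) (hf j)).toLp _) := by
  have hUfin : volume U ≠ ∞ := by
    have := measure_ne_top (volume.restrict U) Set.univ
    rwa [Measure.restrict_apply_univ] at this
  rw [Metric.totallyBounded_iff]
  intro ε hε
  obtain ⟨t, B, hB, H⟩ := exists_step_approx hq hh hU hUfin hM (half_pos hε)
  have hcomp : IsCompact (stepLp (volume.restrict U) t hB '' Set.univ.pi fun _ => Set.Icc (-2) 2) :=
    (isCompact_univ_pi fun _ => isCompact_Icc).image
      (LinearMap.continuous_of_finiteDimensional _)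
  obtain ⟨s, hs, hcov⟩ := Metric.totallyBounded_iff.1 hcomp.totallyBounded (ε / 2) (half_pos hε)
  refine ⟨s, hs, ?_⟩
  rintro _ ⟨j, rfl⟩
  obtain ⟨c, hc, hcε⟩ := H (f j) (hf j) (hfE j)
  have hmem := hcov (Set.mem_image_of_mem (stepLp (volume.restrict U) t hB)
    (show (fun x : t => c x) ∈ Set.univ.pi fun _ => Set.Icc (-2) 2 from fun x _ => hc x))
  simp only [Set.mem_iUnion] at hmem ⊢
  obtain ⟨y, hy, hdist⟩ := hmem
  refine ⟨y, hy, ?_⟩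
  rw [Metric.mem_ball] at hdist ⊢
  refine (dist_triangle _ (stepLp (volume.restrict U) t hB fun x : t => c x) _).trans_lt ?_
  suffices dist ((memLp_arctan_comp (μ := volume.restrict U) (hf j)).toLp _)
      (stepLp (volume.restrict U) t hB fun x : t => c x) < ε / 2 by linarith
  rw [← ENNReal.ofReal_lt_ofReal_iff (half_pos hε), ← edist_dist]
  refine lt_of_eq_of_lt ((Lp.edist_toLp_toLp _ _ _ (memLp_step t hB _)).trans ?_) hcε
  rw [eLpNorm_one_eq_lintegral_enorm]
  refine lintegral_congr fun z => ?_
  rw [Pi.sub_apply, Finset.sum_coe_sort t (fun x => (B x).indicator (fun _ => c x) z)]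

/-! ### Almost everywhere convergent subsequences. -/

/-- Sequences bounded in `W^{h,q}` have almost everywhere convergent subsequences. -/
theorem exists_subseq_tendsto_ae {n : ℕ} {h q : ℝ} (hq : 0 < q) (hh : 0 < h)
    {U : Set (EuclideanSpace ℝ (Fin n))} (hU : IsOpen U) (hUfin : volume U ≠ ∞) {M : ℝ}
    (hM : 0 ≤ M) {f : ℕ → EuclideanSpace ℝ (Fin n) → ℝ}
    (hf : ∀ j, AEStronglyMeasurable (f j) (volume.restrict U))
    (hfq : ∀ j, ∫⁻ x in U, ‖f j x‖ₑ ^ q ≤ ENNReal.ofReal M)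
    (hfE : ∀ j, gagliardoEnergy h q U (f j) ≤ ENNReal.ofReal M) :
    ∃ (g : EuclideanSpace ℝ (Fin n) → ℝ) (φ : ℕ → ℕ), StrictMono φ ∧
      ∀ᵐ x ∂volume.restrict U, Tendsto (fun j => f (φ j) x) atTop (𝓝 (g x)) := by
  have : IsFiniteMeasure (volume.restrict U) :=
    ⟨by rw [Measure.restrict_apply_univ]; exact hUfin.lt_top⟩
  choose f' hf' hff' using hf
  have htb := totallyBounded_range_arctan hq hh hU hM (fun j => (hf' j).measurable)
    (fun j => (gagliardoEnergy_congr (hff' j)) ▸ hfE j)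
  obtain ⟨G, -, φ, hφ, hG⟩ := (htb.closure.isCompact_of_isClosed
    isClosed_closure).tendsto_subseq (fun j => subset_closure (Set.mem_range_self j))
  obtain ⟨ψ, hψ, hψG⟩ := (tendstoInMeasure_of_tendsto_Lp hG).exists_seq_tendsto_ae
  have hconv : ∀ᵐ x ∂volume.restrict U,
      Tendsto (fun j => Real.arctan (f (φ (ψ j)) x)) atTop (𝓝 (G x)) := by
    have h1 : ∀ᵐ x ∂volume.restrict U, ∀ j, f j x = f' j x := ae_all_iff.2 hff'
    have h2 : ∀ᵐ x ∂volume.restrict U, ∀ j,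
        (memLp_arctan_comp (μ := volume.restrict U) (hf' j).measurable).toLp _ x =
          Real.arctan (f' j x) := ae_all_iff.2 fun j => MemLp.coeFn_toLp _
    filter_upwards [h1, h2, hψG] with x hx1 hx2 hx3
    refine hx3.congr fun j => ?_
    rw [hx1]
    exact hx2 _
  -- Fatou: at almost every point some subsequence of values stays bounded, which excludes `±π/2` as
  -- the limit of the arctangents.
  have hliminf : ∀ᵐ x ∂volume.restrict U, liminf (fun j => ‖f (φ (ψ j)) x‖ₑ ^ q) atTop < ∞ := by
    have hm : ∀ j, Measurable (fun x => ‖f' (φ (ψ j)) x‖ₑ ^ q) := fun j =>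
      (hf' _).measurable.enorm.pow_const _
    have hfin : ∀ᵐ x ∂volume.restrict U,
        liminf (fun j => ‖f' (φ (ψ j)) x‖ₑ ^ q) atTop < ∞ := by
      refine ae_lt_top (Measurable.liminf hm) ?_
      refine ((lintegral_liminf_le hm).trans_lt ?_).ne
      refine lt_of_le_of_lt ?_ (ENNReal.ofReal_lt_top (r := M))
      refine liminf_le_of_frequently_le' (Frequently.of_forall fun j => ?_)
      refine (le_of_eq (lintegral_congr_ae ?_)).trans (hfq (φ (ψ j)))
      filter_upwards [hff' (φ (ψ j))] with x hx
      rw [hx]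
    filter_upwards [hfin, ae_all_iff.2 hff'] with x hx1 hx2
    simpa only [hx2] using hx1
  refine ⟨fun x => Real.tan (G x), φ ∘ ψ, hφ.comp hψ, ?_⟩
  filter_upwards [hconv, hliminf] with x hx hfin
  obtain ⟨b, hb, hbt⟩ := exists_between hfin
  have hfreq : ∃ᶠ j in atTop, ‖f (φ (ψ j)) x‖ₑ ^ q < b :=
    frequently_lt_of_liminf_lt (by isBoundedDefault) hb
  set C := (b ^ q⁻¹).toReal with hC
  have hbound : ∃ᶠ j in atTop, |f (φ (ψ j)) x| ≤ C := by
    refine hfreq.mono fun j hj => ?_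
    have h1 : ‖f (φ (ψ j)) x‖ₑ ≤ b ^ q⁻¹ := (ENNReal.le_rpow_inv_iff hq).2 hj.le
    have h2 := ENNReal.toReal_mono (ENNReal.rpow_ne_top_of_nonneg (by positivity) hbt.ne) h1
    rwa [toReal_enorm, Real.norm_eq_abs] at h2
  have hGle : G x ≤ Real.arctan C := le_of_tendsto_of_frequently hx
    (hbound.mono fun j hj => Real.arctan_strictMono.monotone (abs_le.1 hj).2)
  have hGge : Real.arctan (-C) ≤ G x := ge_of_tendsto_of_frequently hx
    (hbound.mono fun j hj => Real.arctan_strictMono.monotone (abs_le.1 hj).1)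
  have hcos : Real.cos (G x) ≠ 0 := (Real.cos_pos_of_mem_Ioo
    ⟨(Real.neg_pi_div_two_lt_arctan _).trans_le hGge,
      hGle.trans_lt (Real.arctan_lt_pi_div_two _)⟩).ne'
  refine ((Real.continuousAt_tan.2 hcos).tendsto.comp hx).congr fun j => ?_
  exact Real.tan_arctan _

/-! ### Vitali convergence. -/

theorem eLpNorm_ofReal_eq {α : Type*} [MeasurableSpace α] {μ : Measure α} {r : ℝ} (hr : 0 < r)
    (f : α → ℝ) : eLpNorm f (ENNReal.ofReal r) μ = (∫⁻ x, ‖f x‖ₑ ^ r ∂μ) ^ (1 / r) := by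
  rw [eLpNorm_eq_lintegral_rpow_enorm_toReal (ENNReal.ofReal_pos.2 hr).ne'
    ENNReal.ofReal_ne_top, ENNReal.toReal_ofReal hr.le]

/-- Above height `T`, `a ^ r = a ^ s / a ^ (s - r)`. The truncated part suits dominated convergence,
and the tail is uniformly small for large `T` under an `s`-moment bound. -/
theorem rpow_le_add_div_rpow {a T : ℝ≥0∞} {r s : ℝ} (hr : 0 < r) (hrs : r < s) (hT : T ≠ 0)
    (hT' : T ≠ ∞) : a ^ r ≤ min a T ^ r + a ^ s / T ^ (s - r) := by
  have hd : 0 < s - r := sub_pos.2 hrs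
  rcases le_total a T with h | h
  · rw [min_eq_left h]
    exact le_self_add
  · refine le_trans ?_ le_add_self
    rw [ENNReal.le_div_iff_mul_le
      (Or.inl (by rw [Ne, ENNReal.rpow_eq_zero_iff_of_pos hd]; exact hT))
      (Or.inl (ENNReal.rpow_ne_top_of_nonneg hd.le hT'))]
    calc a ^ r * T ^ (s - r) ≤ a ^ r * a ^ (s - r) := by gcongr
      _ = a ^ s := by
        rw [← ENNReal.rpow_add_of_nonneg _ _ hr.le hd.le, add_sub_cancel]

/-- Vitali convergence: almost everywhere convergence to zero with bounded higher moments. -/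
theorem tendsto_lintegral_rpow_of_tendsto_ae {α : Type*} [MeasurableSpace α] {μ : Measure α}
    [IsFiniteMeasure μ] {r s : ℝ} (hr : 0 < r) (hrs : r < s) {u : ℕ → α → ℝ}
    (hu : ∀ j, AEStronglyMeasurable (u j) μ) {A : ℝ≥0∞} (hA : A ≠ ∞)
    (hbound : ∀ j, ∫⁻ x, ‖u j x‖ₑ ^ s ∂μ ≤ A)
    (hlim : ∀ᵐ x ∂μ, Tendsto (fun j => u j x) atTop (𝓝 0)) :
    Tendsto (fun j => ∫⁻ x, ‖u j x‖ₑ ^ r ∂μ) atTop (𝓝 0) := by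
  have hd : 0 < s - r := sub_pos.2 hrs
  rw [ENNReal.tendsto_nhds_zero]
  intro ε hε
  have hT : Tendsto (fun k : ℕ => A / ((k : ℝ≥0∞) ^ (s - r))) atTop (𝓝 0) := by
    have h1 := (ENNReal.tendsto_rpow_at_top hd).comp ENNReal.tendsto_nat_nhds_top
    have h2 := ENNReal.Tendsto.const_div h1 (Or.inr hA)
    rwa [ENNReal.div_top] at h2
  have hε2 : 0 < ε / 2 := ENNReal.half_pos hε.ne'
  obtain ⟨k, hk, hk1⟩ := ((hT.eventually (gt_mem_nhds hε2)).and (eventually_ge_atTop 1)).exists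
  have hk0 : (k : ℝ≥0∞) ≠ 0 := by
    rw [Nat.cast_ne_zero]
    omega
  have hmin : ∀ j, AEMeasurable (fun x => min ‖u j x‖ₑ (k : ℝ≥0∞) ^ r) μ := fun j =>
    ((hu j).enorm.min aemeasurable_const).pow_const _
  have hdom : Tendsto (fun j => ∫⁻ x, min ‖u j x‖ₑ (k : ℝ≥0∞) ^ r ∂μ) atTop (𝓝 0) := by
    have := tendsto_lintegral_of_dominated_convergence' (μ := μ) (f := fun _ => 0)
      (fun _ => (k : ℝ≥0∞) ^ r) hmin
      (fun j => .of_forall fun x => ENNReal.rpow_le_rpow (min_le_right _ _) hr.le)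
      (by
        rw [lintegral_const]
        exact ENNReal.mul_ne_top (ENNReal.rpow_ne_top_of_nonneg hr.le (ENNReal.natCast_ne_top k))
          (measure_ne_top _ _)) (by
        filter_upwards [hlim] with x hx
        have h1 : Tendsto (fun j => min ‖u j x‖ₑ (k : ℝ≥0∞)) atTop (𝓝 0) := by
          have h2 := hx.enorm.min (tendsto_const_nhds (x := (k : ℝ≥0∞)))
          simpa using h2
        have h3 := ((ENNReal.continuous_rpow_const (y := r)).tendsto 0).comp h1
        simpa [Function.comp_def, ENNReal.zero_rpow_of_pos hr] using h3)
    simpa using this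
  filter_upwards [hdom.eventually (gt_mem_nhds hε2)] with j hj
  calc ∫⁻ x, ‖u j x‖ₑ ^ r ∂μ
      ≤ ∫⁻ x, (min ‖u j x‖ₑ (k : ℝ≥0∞) ^ r + ‖u j x‖ₑ ^ s / (k : ℝ≥0∞) ^ (s - r)) ∂μ :=
        lintegral_mono fun x =>
          rpow_le_add_div_rpow hr hrs hk0 (ENNReal.natCast_ne_top k)
    _ = ∫⁻ x, min ‖u j x‖ₑ (k : ℝ≥0∞) ^ r ∂μ +
          (∫⁻ x, ‖u j x‖ₑ ^ s ∂μ) / (k : ℝ≥0∞) ^ (s - r) := by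
        rw [lintegral_add_left' (hmin j)]
        simp_rw [div_eq_mul_inv]
        rw [lintegral_mul_const'' _ ((hu j).enorm.pow_const _)]
    _ ≤ ε / 2 + ε / 2 :=
        add_le_add hj.le ((ENNReal.div_le_div_right (hbound j) _).trans hk.le)
    _ = ε := ENNReal.add_halves ε

theorem enorm_sub_rpow_le {s : ℝ} (hs : 0 < s) (a b : ℝ) :
    ‖a - b‖ₑ ^ s ≤ 2 ^ s * (‖a‖ₑ ^ s + ‖b‖ₑ ^ s) := by
  calc ‖a - b‖ₑ ^ s ≤ (2 * max ‖a‖ₑ ‖b‖ₑ) ^ s := by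
        refine ENNReal.rpow_le_rpow (enorm_sub_le.trans ?_) hs.le
        rw [two_mul]
        exact add_le_add (le_max_left _ _) (le_max_right _ _)
    _ = 2 ^ s * max ‖a‖ₑ ‖b‖ₑ ^ s := ENNReal.mul_rpow_of_nonneg _ _ hs.le
    _ ≤ _ := by
        gcongr
        rcases le_total ‖a‖ₑ ‖b‖ₑ with h | h
        · rw [max_eq_right h]; exact le_add_self
        · rw [max_eq_left h]; exact le_self_add

/-! ### The homogeneous Sobolev inequality. -/

theorem fracSobolevNorm_eq {n : ℕ} (h q : ℝ) (U : Set (EuclideanSpace ℝ (Fin n)))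
    (f : EuclideanSpace ℝ (Fin n) → ℝ) : fracSobolevNorm h q U f =
      ((∫⁻ x in U, ‖f x‖ₑ ^ q) + gagliardoEnergy h q U f) ^ (1 / q) := rfl

theorem add_gagliardoEnergy_le {n : ℕ} {h q : ℝ} {U : Set (EuclideanSpace ℝ (Fin n))}
    {f : EuclideanSpace ℝ (Fin n) → ℝ} (hq : 0 < q) {l : ℝ} (hl : 0 ≤ l)
    (hf : fracSobolevNorm h q U f ≤ ENNReal.ofReal l) :
    (∫⁻ x in U, ‖f x‖ₑ ^ q) + gagliardoEnergy h q U f ≤ ENNReal.ofReal (l ^ q) := by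
  rw [fracSobolevNorm_eq, one_div, ENNReal.rpow_inv_le_iff hq,
    ENNReal.ofReal_rpow_of_nonneg hl hq.le] at hf
  exact hf

/-- Subcritical fractional Sobolev inequality. -/
theorem exists_eLpNorm_le_mul_fracSobolevNorm {n : ℕ} {h q : ℝ}
    {U : Set (EuclideanSpace ℝ (Fin n))}
    (hU : IsLipschitzDomain U) (hUb : Bornology.IsBounded U)
    (hq : 0 < q) (hh : 0 < h) (hn : h * q < n)
    {r : ℝ} (hr0 : 0 < r) (hr : r < n * q / (n - h * q)) :
    ∃ C : ℝ≥0, ∀ f : EuclideanSpace ℝ (Fin n) → ℝ, MemFracSobolev h q U f →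
      eLpNorm f (ENNReal.ofReal r) (volume.restrict U) ≤ C * fracSobolevNorm h q U f := by
  obtain ⟨c, hc, R, hR, hdens⟩ := hU.exists_measure_density hUb
  obtain ⟨C, hC⟩ := exists_lintegral_rpow_le hU.1.measurableSet hUb.measure_lt_top.ne hq hh hn
    hc hR hdens hr0 hr
  refine ⟨C ^ (1 / r), fun f hf => ?_⟩
  -- Rescaling by `l⁻¹` puts `f` in the unit ball. The quasinorm may vanish, so `l` is any positive
  -- upper bound, later sent to the quasinorm.
  have key : ∀ l : ℝ, 0 < l → fracSobolevNorm h q U f ≤ ENNReal.ofReal l →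
      eLpNorm f (ENNReal.ofReal r) (volume.restrict U) ≤
        (C ^ (1 / r) : ℝ≥0) * ENNReal.ofReal l := by
    intro l hl hfl
    have hle := add_gagliardoEnergy_le hq hl.le hfl
    have hli : 0 < l⁻¹ := inv_pos.2 hl
    have hone : ENNReal.ofReal (l⁻¹ ^ q) * ENNReal.ofReal (l ^ q) = 1 := by
      rw [← ENNReal.ofReal_mul (by positivity), ← Real.mul_rpow hli.le hl.le,
        inv_mul_cancel₀ hl.ne', Real.one_rpow, ENNReal.ofReal_one]
    have h1 := hC (fun x => l⁻¹ * f x) (hf.1.const_mul _)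
      (by
        rw [lintegral_const_mul_rpow_enorm _ hli hq, ← hone]
        exact mul_le_mul_right (le_self_add.trans hle) _)
      (by
        rw [gagliardoEnergy_const_mul _ hli hq, ← hone]
        exact mul_le_mul_right (le_add_self.trans hle) _)
    have h2 : ∫⁻ x in U, ‖f x‖ₑ ^ r ≤ ENNReal.ofReal (l ^ r) * C := by
      calc ∫⁻ x in U, ‖f x‖ₑ ^ r = ∫⁻ x in U, ‖l * (l⁻¹ * f x)‖ₑ ^ r := by
            simp_rw [mul_inv_cancel_left₀ hl.ne']
        _ = ENNReal.ofReal (l ^ r) * ∫⁻ x in U, ‖l⁻¹ * f x‖ₑ ^ r :=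
            lintegral_const_mul_rpow_enorm _ hl hr0
        _ ≤ _ := by gcongr
    rw [eLpNorm_ofReal_eq hr0, one_div, ENNReal.rpow_inv_le_iff hr0,
      ENNReal.mul_rpow_of_nonneg _ _ hr0.le, ENNReal.ofReal_rpow_of_pos hl, mul_comm,
      ENNReal.coe_rpow_of_nonneg _ (by positivity), ENNReal.rpow_inv_rpow hr0.ne']
    exact h2
  set N := fracSobolevNorm h q U f with hN
  have hNtop : N ≠ ∞ := hf.2.ne
  have hlim : Tendsto (fun k : ℕ => ((C ^ (1 / r) : ℝ≥0) : ℝ≥0∞) *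
      ENNReal.ofReal (N.toReal + 1 / ((k : ℝ) + 1))) atTop
      (𝓝 ((C ^ (1 / r) : ℝ≥0) * ENNReal.ofReal (N.toReal + 0))) :=
    ENNReal.Tendsto.const_mul (ENNReal.tendsto_ofReal
      (tendsto_const_nhds.add tendsto_one_div_add_atTop_nhds_zero_nat))
      (Or.inr ENNReal.coe_ne_top)
  rw [add_zero, ENNReal.ofReal_toReal hNtop] at hlim
  refine ge_of_tendsto' hlim fun k => key _ (by positivity) ?_
  rw [← ENNReal.ofReal_toReal hNtop, ENNReal.toReal_ofReal ENNReal.toReal_nonneg]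
  exact ENNReal.ofReal_le_ofReal (le_add_of_nonneg_right (by positivity))

theorem lintegral_rpow_le_of_eLpNorm_le {α : Type*} [MeasurableSpace α] {μ : Measure α} {r : ℝ}
    (hr : 0 < r) {f : α → ℝ} {A : ℝ≥0∞} (hf : eLpNorm f (ENNReal.ofReal r) μ ≤ A) :
    ∫⁻ x, ‖f x‖ₑ ^ r ∂μ ≤ A ^ r := by
  rwa [eLpNorm_ofReal_eq hr, one_div, ENNReal.rpow_inv_le_iff hr] at hf

theorem lintegral_rpow_enorm_le_of_tendsto_ae {α : Type*} [MeasurableSpace α] {μ : Measure α}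
    {r : ℝ} {f : ℕ → α → ℝ} {g : α → ℝ} {A : ℝ≥0∞}
    (hf : ∀ j, AEStronglyMeasurable (f j) μ) (hbound : ∀ j, ∫⁻ x, ‖f j x‖ₑ ^ r ∂μ ≤ A)
    (hlim : ∀ᵐ x ∂μ, Tendsto (fun j => f j x) atTop (𝓝 (g x))) :
    ∫⁻ x, ‖g x‖ₑ ^ r ∂μ ≤ A := by
  calc ∫⁻ x, ‖g x‖ₑ ^ r ∂μ = ∫⁻ x, liminf (fun j => ‖f j x‖ₑ ^ r) atTop ∂μ := by
        refine lintegral_congr_ae ?_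
        filter_upwards [hlim] with x hx
        exact (((ENNReal.continuous_rpow_const (y := r)).tendsto _).comp hx.enorm).liminf_eq.symm
    _ ≤ liminf (fun j => ∫⁻ x, ‖f j x‖ₑ ^ r ∂μ) atTop :=
        lintegral_liminf_le' fun j => (hf j).enorm.pow_const _
    _ ≤ A := liminf_le_of_frequently_le' (Frequently.of_forall hbound)

/-! ### Compact embedding. -/

theorem lemma2p3 (n : ℕ) (U : Set (EuclideanSpace ℝ (Fin n)))
    (hU : IsLipschitzDomain U) (hUb : Bornology.IsBounded U)
    (h q r : ℝ) (hh0 : 0 < h) (hh1 : h < 1) (hq0 : 0 < q) (hq1 : q < n / h)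
    (hqr : q ≤ r) (hr : r < n * q / (n - h * q)) :
    CompactlyEmbedsInLp h q r U := by
  have hn : h * q < n := by rwa [lt_div_iff₀ hh0, mul_comm] at hq1
  have hr0 : 0 < r := hq0.trans_le hqr
  have hUfin : volume U ≠ ∞ := hUb.measure_lt_top.ne
  have : IsFiniteMeasure (volume.restrict U) :=
    ⟨by rw [Measure.restrict_apply_univ]; exact hUfin.lt_top⟩
  obtain ⟨C, hC⟩ := exists_eLpNorm_le_mul_fracSobolevNorm hU hUb hq0 hh0 hn hr0 hr
  refine ⟨fun f hf => ⟨hf.1, (hC f hf).trans_lt (ENNReal.mul_lt_top ENNReal.coe_lt_top hf.2)⟩,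
    ⟨C, hC⟩, fun f M hf hfM => ?_⟩
  -- The gap between `r` and the critical exponent is spent here: boundedness in `L^s` with `s > r`
  -- is what Vitali needs in `L^r`.
  obtain ⟨s, hrs, hs⟩ := exists_between hr
  have hs0 : 0 < s := hr0.trans hrs
  obtain ⟨C', hC'⟩ := exists_eLpNorm_le_mul_fracSobolevNorm hU hUb hq0 hh0 hn hs0 hs
  have hsum : ∀ j, (∫⁻ x in U, ‖f j x‖ₑ ^ q) + gagliardoEnergy h q U (f j) ≤
      ENNReal.ofReal ((M : ℝ) ^ q) := fun j =>
    add_gagliardoEnergy_le hq0 M.2 (by rw [ENNReal.ofReal_coe_nnreal]; exact hfM j)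
  obtain ⟨g, φ, hφ, hlim⟩ := exists_subseq_tendsto_ae hq0 hh0 hU.1 hUfin
    (Real.rpow_nonneg M.2 q) (fun j => (hf j).1) (fun j => le_self_add.trans (hsum j))
    (fun j => le_add_self.trans (hsum j))
  have hfm : ∀ j, AEStronglyMeasurable (f (φ j)) (volume.restrict U) := fun j => (hf _).1
  have hg : AEStronglyMeasurable g (volume.restrict U) :=
    aestronglyMeasurable_of_tendsto_ae atTop hfm hlim
  have hfr : ∀ j, ∫⁻ x in U, ‖f (φ j) x‖ₑ ^ r ≤ ((C : ℝ≥0∞) * M) ^ r := fun j =>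
    lintegral_rpow_le_of_eLpNorm_le hr0 ((hC _ (hf _)).trans (mul_le_mul_right (hfM _) _))
  have hfs : ∀ j, ∫⁻ x in U, ‖f (φ j) x‖ₑ ^ s ≤ ((C' : ℝ≥0∞) * M) ^ s := fun j =>
    lintegral_rpow_le_of_eLpNorm_le hs0 ((hC' _ (hf _)).trans (mul_le_mul_right (hfM _) _))
  have hgr := lintegral_rpow_enorm_le_of_tendsto_ae hfm hfr hlim
  have hgs := lintegral_rpow_enorm_le_of_tendsto_ae hfm hfs hlim
  have htop : ∀ (D : ℝ≥0) (a : ℝ), 0 < a → ((D : ℝ≥0∞) * M) ^ a ≠ ∞ := fun D a ha =>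
    ENNReal.rpow_ne_top_of_nonneg ha.le (ENNReal.mul_ne_top ENNReal.coe_ne_top ENNReal.coe_ne_top)
  refine ⟨g, ⟨hg, ?_⟩, φ, hφ, ?_⟩
  · rw [eLpNorm_ofReal_eq hr0]
    exact ENNReal.rpow_lt_top_of_nonneg (by positivity) (hgr.trans_lt (htop C r hr0).lt_top).ne
  · have hA : (2 : ℝ≥0∞) ^ s * (((C' : ℝ≥0∞) * M) ^ s + ((C' : ℝ≥0∞) * M) ^ s) ≠ ∞ :=
      ENNReal.mul_ne_top (ENNReal.rpow_ne_top_of_nonneg hs0.le (by simp))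
        (ENNReal.add_ne_top.2 ⟨htop C' s hs0, htop C' s hs0⟩)
    have hvit := tendsto_lintegral_rpow_of_tendsto_ae (u := fun j => f (φ j) - g) hr0 hrs
      (fun j => (hfm j).sub hg) hA
      (fun j => by
        calc ∫⁻ x in U, ‖(f (φ j) - g) x‖ₑ ^ s
            ≤ ∫⁻ x in U, 2 ^ s * (‖f (φ j) x‖ₑ ^ s + ‖g x‖ₑ ^ s) :=
              lintegral_mono fun x => enorm_sub_rpow_le hs0 _ _
          _ = 2 ^ s * ((∫⁻ x in U, ‖f (φ j) x‖ₑ ^ s) + ∫⁻ x in U, ‖g x‖ₑ ^ s) := by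
              rw [lintegral_const_mul' _ _ (ENNReal.rpow_ne_top_of_nonneg hs0.le (by simp)),
                lintegral_add_left' ((hfm j).enorm.pow_const _)]
          _ ≤ _ := by
              gcongr
              exact hfs j)
      (by
        filter_upwards [hlim] with x hx
        simpa using hx.sub_const (g x))
    have h0 := ((ENNReal.continuous_rpow_const (y := 1 / r)).tendsto 0).comp hvit
    rw [ENNReal.zero_rpow_of_pos (by positivity)] at h0
    exact h0.congr fun j => (eLpNorm_ofReal_eq hr0 _).symm
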